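/- All groups are discrete. Let $\Lambda$ be a non-amenable group without non-abelian free subgroups, let $Z$ be a non-trivial group, and let $\Gamma=\Lambda\wr Z=\big(\bigoplus_{z\in Z}\Lambda_z\big)\rtimes Z$ be the restricted wreath product, where each $\Lambda_z$ is a copy of $\Lambda$ and $Z$ permutes the copies by left translation of the index. View $\Lambda$ as the coordinate subgroup $\Lambda_e\le\Gamma$ at the identity $e\in Z$. Then: 1. $\Lambda_e$ is not amenable. 2. $\Lambda_e$ is not co-amenable in $\Gamma$, i.e. there is no $\Gamma$-invariant mean on $\Gamma/\Lambda_e$. 3. If $Z$ is infinite, then $\Lambda_e$ is unconfined in $\Gamma$: for every finite subset $E\subseteq\Gamma$ not containing the identity there is $\gamma\in\Gamma$ such that $\gamma\Lambda_e\gamma^{-1}\cap E=\varnothing$. Moreover, the C*-algebra $C^*(\lambda_{\Gamma/\Lambda_e})$ generated by the quasi-regular representation of $\Gamma$ on $\ell^2(\Gamma/\Lambda_e)$ is exotic: the canonical map $C^*_{\max}(\Gamma)\to C^*_{\mathrm{red}}(\Gamma)$ from the maximal to the reduced C*-algebra of $\Gamma$ factors through the canonical epimorphism $C^*_{\max}(\Gamma)\to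 C^*(\lambda_{\Gamma/\Lambda_e})$ followed by an epimorphism $C^*(\lambda_{\Gamma/\Lambda_e})\to C^*_{\mathrm{red}}(\Gamma)$, and neither of these two epimorphisms is an isomorphism. 4. If $Z$ has no non-abelian free subgroups, then neither does $\Gamma$. In particular, if $Z$ is infinite and has no non-abelian free subgroups, then $\Gamma$ is a group without non-abelian free subgroups for which $C^*(\lambda_{\Gamma/\Lambda_e})$ is an exotic C*-algebra. -/

import Mathlib

open scoped ENNReal

/-! ### Amenability, co-amenability, unconfined subgroups, free subgroups -/

/-- The `G`-set `X` carries a `G`-invariant mean, i.e. a `G`-invariant finitely additive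
probability measure defined on all subsets of `X`. -/
def HasInvariantMean (G X : Type*) [Group G] [MulAction G X] : Prop :=
  ∃ m : Set X → ℝ, (∀ A, 0 ≤ m A) ∧ m Set.univ = 1 ∧
    (∀ A B, Disjoint A B → m (A ∪ B) = m A + m B) ∧
    ∀ (g : G) (A : Set X), m ((fun x => g • x) '' A) = m A

/-- A (discrete) group is amenable if it has a left-invariant mean. -/
def IsAmenableGroup (G : Type*) [Group G] : Prop := HasInvariantMean G G

/-- The subgroup `H` is co-amenable in `G` if there is a `G`-invariant mean on `G ⧸ H`. -/
def IsCoamenable {G : Type*} [Group G] (H : Subgroup G) : Prop := HasInvariantMean G (G ⧸ H)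

/-- `H` is unconfined in `G`: every finite set avoiding the identity is disjoint from some
conjugate `γ H γ⁻¹`, i.e. the trivial subgroup lies in the Chabauty closure of the
conjugacy class of `H`. -/
def IsUnconfined {G : Type*} [Group G] (H : Subgroup G) : Prop :=
  ∀ E : Finset G, (1 : G) ∉ E → ∃ γ : G, ∀ h ∈ H, γ * h * γ⁻¹ ∉ E

/-- Every free subgroup of `G` is abelian. -/
def HasNoNonabelianFreeSubgroup (G : Type*) [Group G] : Prop :=
  ∀ F : Subgroup G, IsFreeGroup F → ∀ a b : F, a * b = b * a

/-! ### Unitary representations and the C*-algebras they generate -/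

section CStar

universe u v w

/-- Surjective linear isometries `e i` of the Hilbert spaces `H i` act coordinatewise on the
Hilbert direct sum of the `H i`. -/
noncomputable def hilbertSumMap {I : Type w} (H : I → Type v) [∀ i, NormedAddCommGroup (H i)]
    [∀ i, InnerProductSpace ℂ (H i)] (e : ∀ i, H i ≃ₗᵢ[ℂ] H i) :
    lp H 2 ≃ₗᵢ[ℂ] lp H 2 where
  toFun f := ⟨fun i => e i (f i), (lp.memℓp f).mono' fun i => by simp⟩
  invFun f := ⟨fun i => (e i).symm (f i), (lp.memℓp f).mono' fun i => by simp⟩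
  map_add' f g := by
    ext i
    simp
    rfl
  map_smul' c f := by ext i; simp
  left_inv f := by ext i; simp
  right_inv f := by ext i; simp
  norm_map' f := by
    simp [lp.norm_eq_tsum_rpow (p := 2) (by norm_num)]

/-- A permutation of `X` acts on `ℓ²(X)` by `(σ f)(x) = f (σ⁻¹ x)`. -/
noncomputable def permEllTwo {X : Type v} (σ : Equiv.Perm X) :
    lp (fun _ : X => ℂ) 2 ≃ₗᵢ[ℂ] lp (fun _ : X => ℂ) 2 where
  toFun f := ⟨fun x => f (σ.symm x), memℓp_gen
    (((lp.memℓp f).summable (by norm_num)).comp_injective σ.symm.injective)⟩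
  invFun f := ⟨fun x => f (σ x), memℓp_gen
    (((lp.memℓp f).summable (by norm_num)).comp_injective σ.injective)⟩
  map_add' f g := by
    ext i
    simp
    rfl
  map_smul' c f := by ext i; simp
  left_inv f := by ext i; simp
  right_inv f := by ext i; simp
  norm_map' f := by
    rw [lp.norm_eq_tsum_rpow (p := 2) (by norm_num), lp.norm_eq_tsum_rpow (p := 2) (by norm_num)]
    congr 1
    exact σ.symm.tsum_eq (fun x => ‖f x‖ ^ (2 : ℝ≥0∞).toReal)

/-- The permutation representation of `G` on `ℓ²(X)`: `(g f)(x) = f (g⁻¹ x)`. -/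
noncomputable def permRep (G : Type u) (X : Type v) [Group G] [MulAction G X] :
    G →* unitary (lp (fun _ : X => ℂ) 2 →L[ℂ] lp (fun _ : X => ℂ) 2) :=
  Unitary.linearIsometryEquiv.symm.toMonoidHom.comp
    { toFun := fun g => permEllTwo (MulAction.toPerm g)
      map_one' := by ext f x; simp [permEllTwo]
      map_mul' := fun g h => by ext f x; simp [permEllTwo, mul_smul] }

/-- The regular representation `λ_G` on `ℓ²(G)`. -/
noncomputable def regularRep (G : Type u) [Group G] :
    G →* unitary (lp (fun _ : G => ℂ) 2 →L[ℂ] lp (fun _ : G => ℂ) 2) :=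
  permRep G G

/-- The quasi-regular representation `λ_{G/H}` on `ℓ²(G/H)`. -/
noncomputable def quasiRegularRep {G : Type u} [Group G] (H : Subgroup G) :
    G →* unitary (lp (fun _ : G ⧸ H => ℂ) 2 →L[ℂ] lp (fun _ : G ⧸ H => ℂ) 2) :=
  permRep G (G ⧸ H)

/-- A unitary representation of `G` on a Hilbert space (in the universe of `G`). -/
structure UnitaryRep (G : Type u) [Group G] : Type (u + 1) where
  space : Type u
  [normed : NormedAddCommGroup space]
  [inner : InnerProductSpace ℂ space]
  [complete : CompleteSpace space]
  hom : G →* unitary (space →L[ℂ] space)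

attribute [instance] UnitaryRep.normed UnitaryRep.inner UnitaryRep.complete

/-- The universal representation of `G`: the Hilbert direct sum of all unitary representations
of `G`. The Hilbert spaces in the universe of `G` suffice, since they include, up to unitary
equivalence, all those that carry a cyclic representation of `G`. -/
noncomputable def universalRep (G : Type u) [Group G] :
    G →* unitary (lp (fun π : UnitaryRep G => π.space) 2 →L[ℂ]
      lp (fun π : UnitaryRep G => π.space) 2) :=
  Unitary.linearIsometryEquiv.symm.toMonoidHom.comp
    { toFun := fun g => hilbertSumMap (fun π : UnitaryRep G => π.space)
        fun π => Unitary.linearIsometryEquiv (π.hom g)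
      map_one' := by ext f π; simp [hilbertSumMap]
      map_mul' := fun g h => by ext f π; simp [hilbertSumMap] }

/-- The C*-algebra `C*(ρ)` generated by a unitary representation `ρ`: the norm closure of the
star-subalgebra of `B(V)` generated by the operators `ρ g`. -/
noncomputable def cstarOf {G : Type u} [Group G] {V : Type v} [NormedAddCommGroup V]
    [InnerProductSpace ℂ V] [CompleteSpace V] (ρ : G →* unitary (V →L[ℂ] V)) :
    StarSubalgebra ℂ (V →L[ℂ] V) :=
  (StarAlgebra.adjoin ℂ (Set.range fun g => (ρ g : V →L[ℂ] V))).topologicalClosure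

/-- The operator `ρ g`, as an element of `C*(ρ)`. -/
noncomputable def cstarOf.mk {G : Type u} [Group G] {V : Type v} [NormedAddCommGroup V]
    [InnerProductSpace ℂ V] [CompleteSpace V] (ρ : G →* unitary (V →L[ℂ] V)) (g : G) :
    cstarOf ρ :=
  ⟨ρ g, StarSubalgebra.le_topologicalClosure _ (StarAlgebra.subset_adjoin ℂ _ ⟨g, rfl⟩)⟩

/-- The maximal C*-algebra of `G`: the completion of the group algebra for the norm
`a ↦ sup ‖π a‖` over all unitary representations `π`, realised as the C*-algebra generated by
the universal representation. -/
noncomputable abbrev cstarMax (G : Type u) [Group G] :=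
  cstarOf (universalRep G)

/-- The reduced C*-algebra of `G`, generated by the regular representation. -/
noncomputable abbrev cstarRed (G : Type u) [Group G] :=
  cstarOf (regularRep G)

/-- `C*(ρ)` is an exotic C*-algebra of `G`: the canonical map `C*max(G) → C*red(G)` factors as
`q ∘ p` through the canonical epimorphism `p : C*max(G) → C*(ρ)` and an epimorphism
`q : C*(ρ) → C*red(G)`, and neither `p` nor `q` is an isomorphism. (The canonical maps are those
that match the operators of each `g : G`, and these generate the algebras.) -/
def IsExotic {G : Type u} [Group G] {V : Type v} [NormedAddCommGroup V]
    [InnerProductSpace ℂ V] [CompleteSpace V] (ρ : G →* unitary (V →L[ℂ] V)) : Prop :=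
  ∃ (p : cstarMax G →⋆ₐ[ℂ] cstarOf ρ) (q : cstarOf ρ →⋆ₐ[ℂ] cstarRed G),
    (∀ g, p (cstarOf.mk (universalRep G) g) = cstarOf.mk ρ g) ∧
    (∀ g, q (cstarOf.mk ρ g) = cstarOf.mk (regularRep G) g) ∧
    Function.Surjective p ∧ Function.Surjective q ∧
    ¬ Function.Bijective p ∧ ¬ Function.Bijective q

end CStar

/-! ### Restricted wreath products -/

section Wreath

variable (L Z : Type*) [Group L] [Group Z]

/-- The restricted wreath product `(⨁_{z ∈ Z} L) ⋊ Z`, as the subgroup of the unrestricted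
regular wreath product that consists of the elements whose lamp configuration `Z → L` has finite
support. -/
def restrictedWreath : Subgroup (RegularWreathProduct L Z) where
  carrier := {x | (Function.mulSupport x.left).Finite}
  one_mem' := by simp
  mul_mem' {a b} ha hb := by
    refine (ha.union (hb.preimage (f := fun z => a.right⁻¹ * z)
      (mul_right_injective _).injOn)).subset ?_
    exact Function.mulSupport_mul _ _
  inv_mem' {a} ha := by
    refine (ha.preimage (f := fun z => a.right * z) (mul_right_injective _).injOn).subset ?_
    intro z hz
    simpa using hz

open Classical in
/-- The embedding of `L` in the restricted wreath product as the copy of `L` at the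
coordinate `z`. -/
noncomputable def lampHom (z : Z) : L →* restrictedWreath L Z where
  toFun l := ⟨⟨Pi.mulSingle z l, 1⟩,
    (Set.finite_singleton z).subset Pi.mulSupport_mulSingle_subset⟩
  map_one' := by ext <;> simp
  map_mul' a b := by
    apply Subtype.ext
    apply RegularWreathProduct.ext
    · funext x
      simp [Pi.mulSingle_mul]
    · simp

/-- The coordinate subgroup of the restricted wreath product at the identity of `Z`. -/
noncomputable def lampSubgroup : Subgroup (restrictedWreath L Z) := (lampHom L Z 1).range

end Wreath

/-! ### Groups without non-abelian free subgroups -/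

/-! Write H for the coordinate subgroup at 1, G for the wreath product. A coset of H remembers its
Z-component z and every lamp except the one at z. Off the cosets over w, the lamp at w is thus an
equivariant map to L for the copy of L at w, so an invariant mean of positive mass there would make
L amenable. Hence each set of cosets avoiding some w is null, and two choices of w contradict total
mass 1. Conjugating H by elements of Z moves it off any finite set of supports, so H is unconfined.

Exoticness holds for every unconfined H that is neither amenable nor co-amenable
(`IsUnconfined.isExotic`). Unconfinedness embeds finite subsets of G in G/H by orbit maps, which
transplants finitely supported vectors and gives q. Injective star-homomorphisms are isometric. If p
were injective, the trivial representation would force ‖∑ λ(g)‖ = |s| on ℓ²(G/H); if q were, the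
H-fixed point mass would force it on ℓ²(G) for s in H. Either equality yields almost invariant
vectors, then an invariant mean (`hasInvariantMean_of_card_le_norm_sum`), which is excluded.

Having no non-abelian free subgroup passes to extensions, because a free group with a non-trivial
abelian normal subgroup is abelian. -/

theorem FreeGroup.eq_of_commute_of {α : Type*} {s t : α}
    (h : FreeGroup.of s * FreeGroup.of t = FreeGroup.of t * FreeGroup.of s) : s = t := by
  classical
  by_contra hst
  have := congrArg FreeGroup.toWord h
  simp [FreeGroup.toWord_mul, FreeGroup.reduce.cons, FreeGroup.toWord_of] at this
  exact hst this.1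

theorem IsFreeGroup.isMulTorsionFree (G : Type*) [Group G] [IsFreeGroup G] :
    IsMulTorsionFree G :=
  Function.Injective.isMulTorsionFree (IsFreeGroup.toFreeGroup G).toMonoidHom
    (IsFreeGroup.toFreeGroup G).injective

/-- A free group with at most one generator is cyclic. -/
theorem IsFreeGroup.exists_zpow_of_subsingleton (G : Type*) [Group G] [IsFreeGroup G]
    [Subsingleton (Generators G)] : ∃ c : G, ∀ x : G, ∃ n : ℤ, c ^ n = x := by
  have key : ∃ c : FreeGroup (Generators G), ∀ i, FreeGroup.of i = c := by
    rcases isEmpty_or_nonempty (Generators G) with he | ⟨⟨i⟩⟩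
    · exact ⟨1, fun i => he.elim i⟩
    · exact ⟨FreeGroup.of i, fun j => by rw [Subsingleton.elim i j]⟩
  obtain ⟨c, hc⟩ := key
  refine ⟨mulEquiv G c, fun x => ?_⟩
  have : ∀ y : FreeGroup (Generators G), y ∈ Subgroup.zpowers c := by
    intro y
    induction y using FreeGroup.induction_on with
    | C1 => exact one_mem _
    | of i => rw [hc i]; exact Subgroup.mem_zpowers c
    | inv_of i hi => exact inv_mem hi
    | mul x y hx hy => exact mul_mem hx hy
  obtain ⟨n, hn⟩ := this ((mulEquiv G).symm x)
  refine ⟨n, ?_⟩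
  rw [← map_zpow]
  simp only at hn
  rw [hn, MulEquiv.apply_symm_apply]

/-- A commutative free group is cyclic. -/
theorem IsFreeGroup.exists_zpow_of_commute {G : Type*} [Group G] [IsFreeGroup G]
    (h : ∀ a b : G, a * b = b * a) : ∃ c : G, ∀ x : G, ∃ n : ℤ, c ^ n = x := by
  have hs : Subsingleton (Generators G) := ⟨fun s t => FreeGroup.eq_of_commute_of <| by
    apply (mulEquiv G).injective
    rw [map_mul, map_mul, h]⟩
  exact exists_zpow_of_subsingleton G

/-- Two commuting elements of a free group are powers of a common element. -/
theorem IsFreeGroup.exists_zpow_zpow_of_commute {G : Type*} [Group G] [IsFreeGroup G] {a b : G}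
    (h : Commute a b) : ∃ (c : G) (m n : ℤ), c ^ m = a ∧ c ^ n = b := by
  have hcomm : ∀ x ∈ ({a, b} : Set G), ∀ y ∈ ({a, b} : Set G), x * y = y * x := by
    rintro x (rfl | rfl) y (rfl | rfl)
    exacts [rfl, h.eq, h.eq.symm, rfl]
  have : ∀ x y : Subgroup.closure ({a, b} : Set G), x * y = y * x :=
    (Subgroup.isMulCommutative_closure hcomm).is_comm.comm
  obtain ⟨c, hc⟩ := exists_zpow_of_commute this
  obtain ⟨m, hm⟩ := hc ⟨a, Subgroup.subset_closure (by simp)⟩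
  obtain ⟨n, hn⟩ := hc ⟨b, Subgroup.subset_closure (by simp)⟩
  exact ⟨c, m, n, congrArg Subtype.val hm, congrArg Subtype.val hn⟩

/-- In a free group with a non-trivial commutative normal subgroup any two elements commute. -/
theorem IsFreeGroup.commute_of_normal_commute {F : Type*} [Group F] [IsFreeGroup F]
    (K : Subgroup F) [K.Normal] (hK : ∀ a b : K, a * b = b * a) (hne : K ≠ ⊥) (a b : F) :
    a * b = b * a := by
  have := IsFreeGroup.isMulTorsionFree F
  obtain ⟨⟨c, hcK⟩, hc⟩ := exists_zpow_of_commute hK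
  replace hc : ∀ x ∈ K, ∃ n : ℤ, c ^ n = x := fun x hx => by
    obtain ⟨n, hn⟩ := hc ⟨x, hx⟩
    exact ⟨n, congrArg Subtype.val hn⟩
  have hc1 : c ≠ 1 := by
    rintro rfl
    refine hne ((Subgroup.eq_bot_iff_forall K).2 fun x hx => ?_)
    obtain ⟨n, rfl⟩ := hc x hx
    simp
  have inj : Function.Injective fun n : ℤ => c ^ n := injective_zpow_iff_not_isOfFinOrder.2 fun h =>
    hc1 ((isOfFinOrder_iff_eq_one c).1 h)
  -- Conjugation by `x` is an automorphism of the infinite cyclic group K, so it sends `c` to `c` or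
  -- its inverse, and its square fixes `c`.
  have hsq : ∀ x : F, Commute (x ^ 2) c := by
    intro x
    obtain ⟨k, hk⟩ := hc _ (Subgroup.Normal.conj_mem ‹_› c hcK x)
    obtain ⟨l, hl⟩ := hc _ (Subgroup.Normal.conj_mem ‹_› c hcK x⁻¹)
    have hkl : l * k = 1 := inj <| by
      simp only [zpow_mul, hl, zpow_one]
      rw [conj_zpow, hk]
      group
    have hkk : k * k = 1 := by
      rcases Int.eq_one_or_neg_one_of_mul_eq_one' hkl with h | h <;> simp [h.2]
    have : x ^ 2 * c * (x ^ 2)⁻¹ = c := by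
      calc x ^ 2 * c * (x ^ 2)⁻¹ = x * (x * c * x⁻¹) * x⁻¹ := by rw [pow_two]; group
        _ = c ^ (k * k) := by rw [← hk, ← conj_zpow, ← hk, zpow_mul]
        _ = c := by rw [hkk, zpow_one]
    exact mul_inv_eq_iff_eq_mul.1 this
  -- With `x ^ 2 = d ^ i` and `c = d ^ j`, both sides are `d ^ (i * j)`; torsion-freeness keeps the
  -- exponents non-zero.
  have hpow : ∀ x : F, x ≠ 1 → ∃ m n : ℤ, m ≠ 0 ∧ n ≠ 0 ∧ x ^ m = c ^ n := by
    intro x hx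
    obtain ⟨d, i, j, hi, hj⟩ := exists_zpow_zpow_of_commute (hsq x)
    refine ⟨2 * j, i, ?_, ?_, ?_⟩
    · rintro h
      obtain rfl : j = 0 := by omega
      exact hc1 (by simpa using hj.symm)
    · rintro rfl
      simp only [zpow_zero] at hi
      exact hx (pow_eq_one_iff_left (n := 2) two_ne_zero |>.1 hi.symm)
    · rw [← hj, zpow_mul, ← zpow_mul d, mul_comm j i, zpow_mul d, hi]
      norm_cast
  -- Distinct generators would share a non-trivial power, which counting exponents of `s` rules out.
  have hs : Subsingleton (Generators F) := ⟨fun s t => by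
    classical
    by_contra hst
    have hof : ∀ i : Generators F, of i ≠ 1 := fun i h => by
      have := congrArg (lift fun _ => Multiplicative.ofAdd (1 : ℤ)) h
      simp at this
    obtain ⟨m, n, hm, hn, h1⟩ := hpow _ (hof s)
    obtain ⟨m', n', hm', hn', h2⟩ := hpow _ (hof t)
    have h3 : (of s : F) ^ (m * n') = of t ^ (m' * n) := by
      rw [zpow_mul, h1, zpow_mul, h2, ← zpow_mul, ← zpow_mul, mul_comm]
    have := congrArg (lift fun i => Multiplicative.ofAdd (if i = s then (1 : ℤ) else 0)) h3
    simp only [map_zpow, lift_of, if_true, if_neg (Ne.symm hst), ofAdd_zero, one_zpow,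
      ← ofAdd_zsmul] at this
    simp [hm, hn'] at this⟩
  obtain ⟨d, hd⟩ := exists_zpow_of_subsingleton F
  obtain ⟨m, rfl⟩ := hd a
  obtain ⟨n, rfl⟩ := hd b
  rw [← zpow_add, ← zpow_add, add_comm]

theorem HasNoNonabelianFreeSubgroup.commute {G F : Type*} [Group G] [Group F]
    (hG : HasNoNonabelianFreeSubgroup G) [IsFreeGroup F] (f : F →* G)
    (hf : Function.Injective f) (a b : F) : a * b = b * a := by
  have h := hG f.range (IsFreeGroup.ofMulEquiv (MonoidHom.ofInjective hf))
    (MonoidHom.ofInjective hf a) (MonoidHom.ofInjective hf b)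
  rw [← map_mul, ← map_mul] at h
  exact (MonoidHom.ofInjective hf).injective h

theorem HasNoNonabelianFreeSubgroup.of_injective {G G' : Type*} [Group G] [Group G']
    (hG : HasNoNonabelianFreeSubgroup G) (f : G' →* G) (hf : Function.Injective f) :
    HasNoNonabelianFreeSubgroup G' := fun F _ =>
  hG.commute (f.comp F.subtype) (hf.comp F.subtype_injective)

/-- The groups without non-abelian free subgroups are closed under extensions. -/
theorem HasNoNonabelianFreeSubgroup.of_extension {G Q : Type*} [Group G] [Group Q] (f : G →* Q)
    (hQ : HasNoNonabelianFreeSubgroup Q) (hK : HasNoNonabelianFreeSubgroup f.ker) :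
    HasNoNonabelianFreeSubgroup G := by
  intro F hF
  set φ : F →* Q := f.comp F.subtype
  -- Either F embeds in Q, or F meets the kernel of `f` in a non-trivial normal subgroup, which is
  -- free by Nielsen–Schreier and hence abelian by `hK`.
  by_cases h : φ.ker = ⊥
  · exact hQ.commute φ ((MonoidHom.ker_eq_bot_iff φ).1 h)
  · refine IsFreeGroup.commute_of_normal_commute φ.ker (hK.commute
      ({ toFun := fun x => ⟨x.1.1, x.2⟩, map_one' := rfl, map_mul' := fun _ _ => rfl } :
        φ.ker →* f.ker) fun x y hxy => ?_) h
    exact Subtype.ext (Subtype.ext (congrArg (fun z : f.ker => (z : G)) hxy))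

theorem hasNoNonabelianFreeSubgroup_of_subsingleton (G : Type*) [Group G] [Subsingleton G] :
    HasNoNonabelianFreeSubgroup G := fun _ _ _ _ => Subsingleton.elim _ _

/-- A group of functions to `L` that are determined by their values on a finite set has no
non-abelian free subgroups if `L` has none. -/
theorem HasNoNonabelianFreeSubgroup.of_finset {L ι G : Type*} [Group L] [Group G]
    (hL : HasNoNonabelianFreeSubgroup L) (s : Finset ι) (f : G →* (ι → L))
    (hf : ∀ x, (∀ i ∈ s, f x i = 1) → x = 1) : HasNoNonabelianFreeSubgroup G := by
  classical
  induction s using Finset.induction_on generalizing G with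
  | empty =>
    have : Subsingleton G := ⟨fun x y => by rw [hf x (by simp), hf y (by simp)]⟩
    exact hasNoNonabelianFreeSubgroup_of_subsingleton G
  | insert i s _ ih =>
    -- Elements of the kernel of evaluation at `i` are determined by their values on the smaller
    -- set.
    refine .of_extension ((Pi.evalMonoidHom (fun _ => L) i).comp f) hL ?_
    refine ih (f.comp (Subgroup.subtype _)) fun x hx => Subtype.ext (hf x fun j hj => ?_)
    rcases Finset.mem_insert.1 hj with rfl | hj
    · exact x.2
    · exact hx j hj

/-- A group of functions to `L` with finite supports has no non-abelian free subgroups if `L` has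
none. -/
theorem HasNoNonabelianFreeSubgroup.of_finite_mulSupport {L ι G : Type*} [Group L] [Group G]
    (hL : HasNoNonabelianFreeSubgroup L) (f : G →* (ι → L)) (hf : Function.Injective f)
    (hfin : ∀ x, (Function.mulSupport (f x)).Finite) : HasNoNonabelianFreeSubgroup G := by
  intro F hF a b
  -- Only the subgroup generated by `a` and `b` matters, and its elements are all trivial off one
  -- finite set.
  let C : Subgroup F := Subgroup.closure {a, b}
  let s : Finset ι := ((hfin a).union (hfin b)).toFinset
  have hC : ∀ x ∈ C, ∀ i ∉ s, f x i = 1 := by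
    intro x hx i hi
    have hle : C ≤ ((Pi.evalMonoidHom (fun _ => L) i).comp (f.comp F.subtype)).ker := by
      rw [Subgroup.closure_le]
      simp only [s, Set.Finite.mem_toFinset, Set.mem_union, Function.mem_mulSupport, not_or,
        not_not] at hi
      rintro x (rfl | rfl)
      exacts [hi.1, hi.2]
    exact hle hx
  have := HasNoNonabelianFreeSubgroup.of_finset (G := C) hL s
    ((f.comp F.subtype).comp C.subtype) (fun x hx => by
      refine Subtype.ext (Subtype.ext (hf ?_))
      funext i
      by_cases hi : i ∈ s
      · simpa using hx i hi
      · simpa using hC x x.2 i hi)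
  have h := this.commute (MonoidHom.id C) Function.injective_id
    ⟨a, Subgroup.subset_closure (by simp)⟩ ⟨b, Subgroup.subset_closure (by simp)⟩
  exact congrArg Subtype.val h

theorem hasNoNonabelianFreeSubgroup_restrictedWreath {L Z : Type*} [Group L] [Group Z]
    (hL : HasNoNonabelianFreeSubgroup L) (hZ : HasNoNonabelianFreeSubgroup Z) :
    HasNoNonabelianFreeSubgroup (restrictedWreath L Z) := by
  refine .of_extension (RegularWreathProduct.rightHom.comp (Subgroup.subtype _)) hZ ?_
  have hr : ∀ x : ((RegularWreathProduct.rightHom : RegularWreathProduct L Z →* Z).comp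
      (restrictedWreath L Z).subtype).ker, x.1.1.right = 1 := fun x => x.2
  refine hL.of_finite_mulSupport
    { toFun := fun x => x.1.1.left
      map_one' := rfl
      map_mul' := fun x y => by
        funext z
        simp [hr x] } (fun x y h => ?_) fun x => x.1.2
  exact Subtype.ext (Subtype.ext (RegularWreathProduct.ext h ((hr x).trans (hr y).symm)))

/-! ### Invariant means -/

/-- An invariant mean on `X` yields the amenability of `K`, if `K` acts on `X` through a
homomorphism and some invariant set of positive mass maps equivariantly to `K`. -/
theorem isAmenableGroup_of_mean {G X K : Type*} [Group G] [MulAction G X] [Group K]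
    {m : Set X → ℝ} (hpos : ∀ A, 0 ≤ m A)
    (hadd : ∀ A B, Disjoint A B → m (A ∪ B) = m A + m B)
    (hinv : ∀ (g : G) (A : Set X), m ((fun x => g • x) '' A) = m A)
    (j : K →* G) (A : Set X) (hA : m A ≠ 0) (hjA : ∀ k, ∀ x ∈ A, j k • x ∈ A)
    (φ : X → K) (hφ : ∀ k, ∀ x ∈ A, φ (j k • x) = k * φ x) : IsAmenableGroup K := by
  -- The mean on K is the push-forward under `φ` of `m` restricted to `A` and normalised.
  refine ⟨fun B => m (A ∩ φ ⁻¹' B) / m A, fun B => div_nonneg (hpos _) (hpos _), ?_, ?_, ?_⟩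
  · simp [hA]
  · intro B C hBC
    beta_reduce
    rw [Set.preimage_union, Set.inter_union_distrib_left, hadd, add_div]
    exact (hBC.preimage φ).mono Set.inter_subset_right Set.inter_subset_right
  · intro k B
    beta_reduce
    rw [← hinv (j k) (A ∩ φ ⁻¹' B)]
    congr 2
    ext x
    simp only [smul_eq_mul, Set.mem_inter_iff, Set.mem_preimage, Set.mem_image]
    constructor
    · rintro ⟨hx, b, hb, hbx⟩
      refine ⟨j k⁻¹ • x, ⟨hjA _ x hx, ?_⟩, ?_⟩
      · rw [hφ _ x hx, ← hbx, inv_mul_cancel_left]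
        exact hb
      · rw [smul_smul, ← map_mul, mul_inv_cancel, map_one, one_smul]
    · rintro ⟨y, ⟨hy, hyB⟩, rfl⟩
      exact ⟨hjA _ y hy, φ y, hyB, (hφ k y hy).symm⟩

theorem HasInvariantMean.isAmenableGroup {G X K : Type*} [Group G] [MulAction G X] [Group K]
    (h : HasInvariantMean G X) (j : K →* G) (φ : X → K) (hφ : ∀ k x, φ (j k • x) = k * φ x) :
    IsAmenableGroup K := by
  obtain ⟨m, hpos, huniv, hadd, hinv⟩ := h
  exact isAmenableGroup_of_mean hpos hadd hinv j Set.univ (by simp [huniv]) (by simp) φ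
    fun k x _ => hφ k x

/-- A subgroup `H` is amenable if the `H`-set `G` has an invariant mean. -/
theorem isAmenableGroup_of_hasInvariantMean_subgroup {G : Type*} [Group G] (H : Subgroup G)
    (h : HasInvariantMean H G) : IsAmenableGroup H := by
  -- Choosing representatives of the cosets Hx makes the H-component of `x` an H-equivariant map
  -- from G to H.
  let rep : G → G := fun x => (Quotient.mk (QuotientGroup.rightRel H) x).out
  have hrep : ∀ x, x * (rep x)⁻¹ ∈ H := fun x =>
    QuotientGroup.rightRel_apply.1 (Quotient.mk_out (s := QuotientGroup.rightRel H) x)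
  refine h.isAmenableGroup (MonoidHom.id H) (fun x => ⟨x * (rep x)⁻¹, hrep x⟩) fun k x => ?_
  have hk : rep (k • x) = rep x := by
    refine congrArg Quotient.out (Quotient.sound (QuotientGroup.rightRel_apply.2 ?_))
    have : x * (k • x)⁻¹ = (k : G)⁻¹ := by
      rw [Subgroup.smul_def, smul_eq_mul, mul_inv_rev, mul_inv_cancel_left]
    rw [this]
    exact inv_mem k.2
  apply Subtype.ext
  simp only [MonoidHom.id_apply, hk, Subgroup.coe_mul]
  rw [Subgroup.smul_def, smul_eq_mul, mul_assoc]

/-! ### The lamp subgroup -/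

section Lamp

variable {L Z : Type*} [Group L] [Group Z]

theorem lampHom_injective (z : Z) : Function.Injective (lampHom L Z z) := by
  classical
  intro a b h
  have := congrArg (fun x : restrictedWreath L Z => x.1.left z) h
  simpa [lampHom] using this

theorem not_isAmenableGroup_lampSubgroup (hL : ¬ IsAmenableGroup L) :
    ¬ IsAmenableGroup (lampSubgroup L Z) := by
  intro h
  let e : L ≃* lampSubgroup L Z := MonoidHom.ofInjective (lampHom_injective 1)
  refine hL (HasInvariantMean.isAmenableGroup h e.toMonoidHom e.symm fun k x => ?_)
  simp

open Classical in
theorem lampHom_left (z w : Z) (l : L) :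
    (lampHom L Z z l).1.left w = if w = z then l else 1 := by
  simp [lampHom, Pi.mulSingle_apply]

theorem lampHom_right (z : Z) (l : L) : (lampHom L Z z l).1.right = 1 := rfl

open Classical in
/-- The second coordinate of a coset of the lamp subgroup is well defined, and so is its lamp at
`w` as long as the second coordinate is not `w`. -/
theorem exists_lamp_coordinate (w : Z) :
    ∃ (r : restrictedWreath L Z ⧸ lampSubgroup L Z → Z)
      (φ : restrictedWreath L Z ⧸ lampSubgroup L Z → L),
      (∀ γ : restrictedWreath L Z, r γ = γ.1.right) ∧
      (∀ γ : restrictedWreath L Z, γ.1.right ≠ w → φ γ = γ.1.left w) := by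
  have hrel : ∀ a b : restrictedWreath L Z, QuotientGroup.leftRel (lampSubgroup L Z) a b →
      ∃ l, b = a * lampHom L Z 1 l := by
    intro a b hab
    obtain ⟨l, hl⟩ := QuotientGroup.leftRel_apply.1 hab
    exact ⟨l, by rw [hl, mul_inv_cancel_left]⟩
  -- Right multiplication by the lamp subgroup changes only the lamp at the second coordinate; the
  -- value 1 over `w` is a dummy.
  refine ⟨Quotient.lift (fun γ => γ.1.right) fun a b hab => ?_,
    Quotient.lift (fun γ => if γ.1.right = w then 1 else γ.1.left w) fun a b hab => ?_,
    fun γ => rfl, fun γ hγ => ?_⟩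
  · obtain ⟨l, rfl⟩ := hrel a b hab
    simp [lampHom_right]
  · obtain ⟨l, rfl⟩ := hrel a b hab
    by_cases h : a.1.right = w
    · simp [lampHom_right, h]
    · have h' : ¬ a.1.right⁻¹ * w = 1 := fun h' => h (inv_mul_eq_one.1 h')
      simp [lampHom_right, lampHom_left, h, h']
  · change (if γ.1.right = w then 1 else γ.1.left w) = _
    rw [if_neg hγ]

theorem not_isCoamenable_lampSubgroup [Nontrivial Z] (hL : ¬ IsAmenableGroup L) :
    ¬ IsCoamenable (lampSubgroup L Z) := by
  rintro ⟨m, hpos, huniv, hadd, hinv⟩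
  obtain ⟨r, -, hr, -⟩ := exists_lamp_coordinate (L := L) (1 : Z)
  -- Over `T` the lamp at `w` is defined and equivariant under the copy of L at `w`, so positive
  -- mass would make L amenable.
  have key : ∀ (w : Z) (T : Set Z), w ∉ T → m (r ⁻¹' T) = 0 := by
    intro w T hw
    by_contra hne
    obtain ⟨-, φ, -, hφ⟩ := exists_lamp_coordinate (L := L) w
    have hr' : ∀ (k : L) (γ : restrictedWreath L Z), (lampHom L Z w k * γ).1.right = γ.1.right :=
      fun k γ => by simp [lampHom_right]
    refine hL (isAmenableGroup_of_mean hpos hadd hinv (lampHom L Z w) (r ⁻¹' T) hne ?_ φ ?_)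
    · intro k x hx
      induction x using QuotientGroup.induction_on with | _ γ
      rw [MulAction.Quotient.smul_coe, Set.mem_preimage, hr, smul_eq_mul, hr', ← hr]
      exact hx
    · intro k x hx
      induction x using QuotientGroup.induction_on with | _ γ
      have hγ : γ.1.right ≠ w := by
        rintro rfl
        exact hw (by rwa [Set.mem_preimage, hr] at hx)
      rw [MulAction.Quotient.smul_coe, smul_eq_mul, hφ _ (by rwa [hr']), hφ _ hγ]
      simp [lampHom_left, lampHom_right]
  obtain ⟨z, hz⟩ := exists_ne (1 : Z)
  -- Each half of the partition misses a point of Z, so both halves are null.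
  have h1 := key 1 {1}ᶜ (by simp)
  have h2 := key z {1} (by simpa using hz)
  have h3 := hadd (r ⁻¹' {1}) (r ⁻¹' {1}ᶜ) (disjoint_compl_right.preimage r)
  rw [← Set.preimage_union, Set.union_compl_self, Set.preimage_univ, huniv, h1, h2] at h3
  norm_num at h3

/-- Conjugation by `s` in Z carries the copy of L at 1 to the copy at `s`; an `s` outside all
supports of elements of `E` exists as Z is infinite. -/
theorem isUnconfined_lampSubgroup [Infinite Z] : IsUnconfined (lampSubgroup L Z) := by
  classical
  intro E hE
  have hfin : (⋃ x ∈ E, Function.mulSupport x.1.left).Finite :=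
    E.finite_toSet.biUnion fun x _ => x.2
  obtain ⟨s, hs⟩ := hfin.exists_notMem
  simp only [Set.mem_iUnion, not_exists, Function.mem_mulSupport, not_not] at hs
  let γ : restrictedWreath L Z := ⟨RegularWreathProduct.inl s, by simp [restrictedWreath]⟩
  refine ⟨γ, ?_⟩
  rintro _ ⟨l, rfl⟩ hmem
  have h := hs _ hmem
  obtain rfl : l = 1 := by simpa [γ, lampHom_left, lampHom_right] using h
  exact hE (by simpa using hmem)

end Lamp

/-! ### Ranges of star-homomorphisms -/

section Range

variable {A B : Type*} [CStarAlgebra A] [CStarAlgebra B]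

/-- Functional calculus truncates `a` to [-r, r] with r = ‖φ a‖. The spectrum of `φ a` already lies
there, so the image is unchanged. -/
theorem StarAlgHom.exists_norm_le_of_isSelfAdjoint (φ : A →⋆ₐ[ℂ] B) {a : A}
    (ha : IsSelfAdjoint a) : ∃ a', φ a' = φ a ∧ ‖a'‖ ≤ ‖φ a‖ := by
  have hφ : Continuous φ := AddMonoidHomClass.continuous_of_bound φ 1
    (by simpa only [one_mul] using NonUnitalStarAlgHom.norm_apply_le φ)
  have hφa : IsSelfAdjoint (φ a) := ha.map φ
  set r := ‖φ a‖
  have hr : 0 ≤ r := norm_nonneg _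
  let f : ℝ → ℝ := fun x => max (-r) (min x r)
  have hf : Continuous f := by fun_prop
  refine ⟨cfc f a, ?_, norm_cfc_le hr fun x _ => ?_⟩
  · rw [StarAlgHomClass.map_cfc φ f a hf.continuousOn hφ]
    conv_rhs => rw [← cfc_id' ℝ (φ a)]
    refine cfc_congr fun x hx => ?_
    have h := norm_apply_le_norm_cfc (fun x : ℝ => x) (φ a) hx
    rw [cfc_id' ℝ (φ a), Real.norm_eq_abs, abs_le] at h
    simp only [f]
    rw [min_eq_left h.2, max_eq_right h.1]
  · rw [Real.norm_eq_abs, abs_le]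
    exact ⟨le_max_left _ _, max_le (by linarith) (min_le_right _ _)⟩

/-- Real and imaginary parts are lifted separately, whence the factor 2. Any uniform bound suffices
to show that the range is closed. -/
theorem StarAlgHom.exists_norm_le (φ : A →⋆ₐ[ℂ] B) (a : A) :
    ∃ a', φ a' = φ a ∧ ‖a'‖ ≤ 2 * ‖φ a‖ := by
  obtain ⟨x, hx, hxn⟩ := φ.exists_norm_le_of_isSelfAdjoint (realPart a).2
  obtain ⟨y, hy, hyn⟩ := φ.exists_norm_le_of_isSelfAdjoint (imaginaryPart a).2
  have hsmul : ∀ (r : ℝ) (x : A), φ (r • x) = r • φ x := fun r x => by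
    rw [← Complex.coe_smul, map_smul, Complex.coe_smul]
  have hre : φ (realPart a : A) = (realPart (φ a) : B) := by
    simp [realPart_apply_coe, map_star, hsmul]
  have him : φ (imaginaryPart a : A) = (imaginaryPart (φ a) : B) := by
    simp [imaginaryPart_apply_coe, map_star, hsmul]
  refine ⟨x + Complex.I • y, ?_, ?_⟩
  · rw [map_add, map_smul, hx, hy, ← map_smul, ← map_add, realPart_add_I_smul_imaginaryPart]
  · have h1 : ‖x‖ ≤ ‖φ a‖ := hxn.trans (hre ▸ realPart.norm_le (φ a))
    have h2 : ‖y‖ ≤ ‖φ a‖ := hyn.trans (him ▸ imaginaryPart.norm_le (φ a))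
    calc ‖x + Complex.I • y‖ ≤ ‖x‖ + ‖Complex.I • y‖ := norm_add_le _ _
      _ ≤ 2 * ‖φ a‖ := by rw [norm_smul, Complex.norm_I]; linarith

/-- The range of a star-homomorphism of C⋆-algebras is closed. -/
theorem StarAlgHom.isClosed_range (φ : A →⋆ₐ[ℂ] B) : IsClosed (Set.range φ) := by
  let f : NormedAddGroupHom A B := (φ : A →+ B).mkNormedAddGroupHom 1
    fun a => by rw [one_mul]; exact NonUnitalStarAlgHom.norm_apply_le φ a
  have hf : f.SurjectiveOnWith f.range 2 := by
    rintro _ ⟨a, rfl⟩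
    exact φ.exists_norm_le a
  have h := controlled_closure_of_complete two_pos one_pos hf
  refine isClosed_of_closure_subset fun b hb => ?_
  obtain ⟨a, ha, -⟩ := h b hb
  exact ⟨a, ha⟩

end Range

/-! ### Canonical maps between the C⋆-algebras of representations -/

section Canonical

universe u v w

variable {G : Type u} [Group G] {V : Type v} [NormedAddCommGroup V]
  [InnerProductSpace ℂ V] [CompleteSpace V] {W : Type w} [NormedAddCommGroup W]
  [InnerProductSpace ℂ W] [CompleteSpace W]

/-- The star-algebra generated by a group of unitaries is its linear span. -/
theorem mem_adjoin_range_iff {A : Type*} [Ring A] [StarRing A] [Algebra ℂ A] [StarModule ℂ A]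
    (ρ : G →* A) (hρ : ∀ g, star (ρ g) = ρ g⁻¹) (x : A)
    (hx : x ∈ StarAlgebra.adjoin ℂ (Set.range ρ)) :
    ∃ c : G →₀ ℂ, (c.sum fun g a => a • ρ g) = x := by
  rw [← Finsupp.mem_span_range_iff_exists_finsupp]
  induction hx using StarAlgebra.adjoin_induction with
  | mem x hx => exact Submodule.subset_span hx
  | algebraMap r =>
    rw [Algebra.algebraMap_eq_smul_one]
    exact Submodule.smul_mem _ _ (Submodule.subset_span ⟨1, map_one ρ⟩)
  | add x y _ _ hx hy => exact add_mem hx hy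
  | mul x y _ _ hx hy =>
    have := Submodule.mul_mem_mul hx hy
    rw [Submodule.span_mul_span] at this
    refine Submodule.span_mono ?_ this
    rintro _ ⟨_, ⟨g, rfl⟩, _, ⟨h, rfl⟩, rfl⟩
    exact ⟨g * h, map_mul ρ g h⟩
  | star x hx' hx =>
    clear hx'
    induction hx using Submodule.span_induction with
    | mem x hx =>
      obtain ⟨g, rfl⟩ := hx
      exact Submodule.subset_span ⟨g⁻¹, (hρ g).symm⟩
    | zero => simp
    | add x y _ _ hx hy => rw [star_add]; exact add_mem hx hy
    | smul a x _ hx => rw [star_smul]; exact Submodule.smul_mem _ _ hx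

/-- If a set of generators maps to another, then a star-homomorphism maps the closed star-algebra
of the first onto that of the second. -/
theorem StarAlgHom.image_topologicalClosure_adjoin {A B ι : Type*} [CStarAlgebra A]
    [CStarAlgebra B] (φ : A →⋆ₐ[ℂ] B) (v : ι → A) :
    φ '' ((StarAlgebra.adjoin ℂ (Set.range v)).topologicalClosure : Set A) =
      (StarAlgebra.adjoin ℂ (Set.range fun i => φ (v i))).topologicalClosure := by
  set S := (StarAlgebra.adjoin ℂ (Set.range v)).topologicalClosure
  have hφ : Continuous φ := AddMonoidHomClass.continuous_of_bound φ 1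
    (by simpa only [one_mul] using NonUnitalStarAlgHom.norm_apply_le φ)
  have hadj : (StarAlgebra.adjoin ℂ (Set.range v)).map φ =
      StarAlgebra.adjoin ℂ (Set.range fun i => φ (v i)) := by
    rw [StarAlgHom.map_adjoin, ← Set.range_comp]
    rfl
  apply Set.Subset.antisymm
  · rw [← hadj]
    exact image_closure_subset_closure_image hφ
  · have hS : IsClosed (S : Set A) := StarSubalgebra.isClosed_topologicalClosure _
    have hcl : IsClosed (φ '' (S : Set A)) := by
      have := (φ.comp S.subtype).isClosed_range
      rwa [StarAlgHom.coe_comp, Set.range_comp, StarSubalgebra.coe_subtype,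
        Subtype.range_coe] at this
    refine closure_minimal ?_ hcl
    rw [← hadj]
    exact Set.image_mono (StarSubalgebra.le_topologicalClosure _)

/-- If `σ` weakly contains `ρ`, then there is a canonical epimorphism from the C⋆-algebra of `σ`
to that of `ρ`. -/
theorem exists_canonical_epimorphism (σ : G →* unitary (V →L[ℂ] V))
    (ρ : G →* unitary (W →L[ℂ] W))
    (h : ∀ c : G →₀ ℂ, ‖c.sum fun g a => a • (ρ g : W →L[ℂ] W)‖ ≤
      ‖c.sum fun g a => a • (σ g : V →L[ℂ] V)‖) :
    ∃ φ : cstarOf σ →⋆ₐ[ℂ] cstarOf ρ,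
      (∀ g, φ (cstarOf.mk σ g) = cstarOf.mk ρ g) ∧ Function.Surjective φ := by
  -- The epimorphism is obtained from its graph `S`, the closed algebra generated by the pairs (σ g,
  -- ρ g). The norm inequality persists on `S`, so the first projection is injective there.
  let τ : G →* (V →L[ℂ] V) × (W →L[ℂ] W) :=
    ((unitary (V →L[ℂ] V)).subtype.comp σ).prod ((unitary (W →L[ℂ] W)).subtype.comp ρ)
  let S := (StarAlgebra.adjoin ℂ (Set.range τ)).topologicalClosure
  have hS : IsClosed (S : Set ((V →L[ℂ] V) × (W →L[ℂ] W))) :=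
    StarSubalgebra.isClosed_topologicalClosure _
  have hnorm : ∀ x ∈ S, ‖x.2‖ ≤ ‖x.1‖ := by
    intro x hx
    refine closure_minimal (t := {x : (V →L[ℂ] V) × (W →L[ℂ] W) | ‖x.2‖ ≤ ‖x.1‖}) ?_
      (isClosed_le (by fun_prop) (by fun_prop)) hx
    intro y hy
    obtain ⟨c, rfl⟩ := mem_adjoin_range_iff τ (fun g => by
      refine Prod.ext ?_ ?_
      · change star (σ g : V →L[ℂ] V) = (σ g⁻¹ : V →L[ℂ] V)
        rw [map_inv]
        rfl
      · change star (ρ g : W →L[ℂ] W) = (ρ g⁻¹ : W →L[ℂ] W)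
        rw [map_inv]
        rfl) y hy
    have h1 : (c.sum fun g a => a • τ g).1 = c.sum fun g a => a • (σ g : V →L[ℂ] V) := by
      simp [Finsupp.sum, Prod.fst_sum, τ]
    have h2 : (c.sum fun g a => a • τ g).2 = c.sum fun g a => a • (ρ g : W →L[ℂ] W) := by
      simp [Finsupp.sum, Prod.snd_sum, τ]
    rw [Set.mem_ofPred_eq, h1, h2]
    exact h c
  have h1 : Prod.fst '' (S : Set ((V →L[ℂ] V) × (W →L[ℂ] W))) = cstarOf σ :=
    (StarAlgHom.fst ℂ (V →L[ℂ] V) (W →L[ℂ] W)).image_topologicalClosure_adjoin τ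
  have h2 : Prod.snd '' (S : Set ((V →L[ℂ] V) × (W →L[ℂ] W))) = cstarOf ρ :=
    (StarAlgHom.snd ℂ (V →L[ℂ] V) (W →L[ℂ] W)).image_topologicalClosure_adjoin τ
  let p : S →⋆ₐ[ℂ] cstarOf σ :=
    ((StarAlgHom.fst ℂ (V →L[ℂ] V) (W →L[ℂ] W)).comp S.subtype).codRestrict _
      fun x => h1.le ⟨x, x.2, rfl⟩
  let q : S →⋆ₐ[ℂ] cstarOf ρ :=
    ((StarAlgHom.snd ℂ (V →L[ℂ] V) (W →L[ℂ] W)).comp S.subtype).codRestrict _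
      fun x => h2.le ⟨x, x.2, rfl⟩
  have hp : Function.Bijective p := by
    constructor
    · rw [injective_iff_map_eq_zero]
      intro x hx
      have hx1 : x.1.1 = 0 := congrArg Subtype.val hx
      have hx2 : x.1.2 = 0 := by
        have := hnorm x x.2
        rw [hx1, norm_zero] at this
        exact norm_le_zero_iff.1 this
      exact Subtype.ext (Prod.ext hx1 hx2)
    · intro y
      obtain ⟨x, hx, hxy⟩ := h1.ge y.2
      exact ⟨⟨x, hx⟩, Subtype.ext hxy⟩
  have hq : Function.Surjective q := by
    intro y
    obtain ⟨x, hx, hxy⟩ := h2.ge y.2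
    exact ⟨⟨x, hx⟩, Subtype.ext hxy⟩
  let e : S ≃⋆ₐ[ℂ] cstarOf σ := StarAlgEquiv.ofBijective p hp
  refine ⟨q.comp (e.symm : cstarOf σ →⋆ₐ[ℂ] S), fun g => ?_, hq.comp e.symm.surjective⟩
  have hg : e.symm (cstarOf.mk σ g) = ⟨τ g, StarSubalgebra.le_topologicalClosure _
      (StarAlgebra.subset_adjoin ℂ _ ⟨g, rfl⟩)⟩ := by
    rw [StarAlgEquiv.symm_apply_eq]
    rfl
  change q (e.symm (cstarOf.mk σ g)) = _
  rw [hg]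
  rfl

/-- A bijective canonical map preserves the norms of sums of group elements. -/
theorem norm_sum_eq_of_canonical_injective {σ : G →* unitary (V →L[ℂ] V)}
    {ρ : G →* unitary (W →L[ℂ] W)} (φ : cstarOf σ →⋆ₐ[ℂ] cstarOf ρ)
    (hφ : ∀ g, φ (cstarOf.mk σ g) = cstarOf.mk ρ g) (hinj : Function.Injective φ)
    (s : Finset G) : ‖∑ g ∈ s, (ρ g : W →L[ℂ] W)‖ = ‖∑ g ∈ s, (σ g : V →L[ℂ] V)‖ := by
  -- Closedness makes both algebras C⋆-algebras, so that the injective `φ` is isometric.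
  have hσ : IsClosed (cstarOf σ : Set (V →L[ℂ] V)) :=
    StarSubalgebra.isClosed_topologicalClosure _
  have hρ : IsClosed (cstarOf ρ : Set (W →L[ℂ] W)) :=
    StarSubalgebra.isClosed_topologicalClosure _
  have h := NonUnitalStarAlgHom.norm_map φ hinj (∑ g ∈ s, cstarOf.mk σ g)
  have h1 : ((∑ g ∈ s, cstarOf.mk σ g : cstarOf σ) : V →L[ℂ] V) = ∑ g ∈ s, (σ g : V →L[ℂ] V) :=
    map_sum (cstarOf σ).subtype _ _
  have h2 : ((∑ g ∈ s, cstarOf.mk ρ g : cstarOf ρ) : W →L[ℂ] W) = ∑ g ∈ s, (ρ g : W →L[ℂ] W) :=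
    map_sum (cstarOf ρ).subtype _ _
  rw [map_sum, Finset.sum_congr rfl fun g _ => hφ g] at h
  rw [← h1, ← h2]
  exact h

end Canonical

/-! ### Permutation representations -/

section PermRep

universe u v

variable {G : Type u} [Group G] {X : Type v} [MulAction G X]

theorem permRep_apply (g : G) (f : lp (fun _ : X => ℂ) 2) (x : X) :
    (permRep G X g : lp (fun _ : X => ℂ) 2 →L[ℂ] lp (fun _ : X => ℂ) 2) f x = f (g⁻¹ • x) :=
  rfl

theorem norm_permRep_apply (g : G) (f : lp (fun _ : X => ℂ) 2) :
    ‖(permRep G X g : lp (fun _ : X => ℂ) 2 →L[ℂ] lp (fun _ : X => ℂ) 2) f‖ = ‖f‖ :=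
  (permEllTwo (MulAction.toPerm g)).norm_map f

open Classical in
theorem permRep_single (g : G) (x : X) (a : ℂ) :
    (permRep G X g : lp (fun _ : X => ℂ) 2 →L[ℂ] lp (fun _ : X => ℂ) 2)
      (lp.single 2 x a) = lp.single 2 (g • x) a := by
  ext y
  rw [permRep_apply, lp.single_apply, lp.single_apply]
  simp only [Pi.single_apply, inv_smul_eq_iff]

open Classical in
/-- The linear map `ℂ[G] → ℓ²(X)` induced by the orbit map of `x`. -/
noncomputable def orbitMap (G : Type u) [Group G] [MulAction G X] (x : X) :
    (G →₀ ℂ) →ₗ[ℂ] lp (fun _ : X => ℂ) 2 :=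
  Finsupp.linearCombination ℂ fun g => lp.single 2 (g • x) (1 : ℂ)

open Classical in
theorem norm_orbitMap (x : X) (b : G →₀ ℂ)
    (hinj : Set.InjOn (fun g : G => g • x) b.support) :
    ‖orbitMap G x b‖ ^ (2 : ℝ≥0∞).toReal = ∑ g ∈ b.support, ‖b g‖ ^ (2 : ℝ≥0∞).toReal := by
  have h : orbitMap G x b = ∑ y ∈ b.support.image (fun g : G => g • x),
      lp.single 2 y (Finsupp.mapDomain (fun g : G => g • x) b y) := by
    rw [Finset.sum_image hinj, orbitMap, Finsupp.linearCombination_apply, Finsupp.sum]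
    refine Finset.sum_congr rfl fun g hg => ?_
    rw [Finsupp.mapDomain_apply' _ _ subset_rfl hinj hg, ← lp.single_smul]
    simp
  rw [h, lp.norm_sum_single (by norm_num), Finset.sum_image hinj]
  refine Finset.sum_congr rfl fun g hg => ?_
  rw [Finsupp.mapDomain_apply' _ _ subset_rfl hinj hg]

/-- The group-algebra product on the right does not depend on `X` or `x`, which allows ℓ²(G) and
ℓ²(X) to be compared. -/
theorem sum_permRep_orbitMap (x : X) (c b : G →₀ ℂ) :
    (c.sum fun g a => a • (permRep G X g : lp (fun _ : X => ℂ) 2 →L[ℂ] lp (fun _ : X => ℂ) 2))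
      (orbitMap G x b) =
    orbitMap G x (c.sum fun g a => a • Finsupp.mapDomain (fun h => g * h) b) := by
  classical
  have key : ∀ g : G, (permRep G X g : lp (fun _ : X => ℂ) 2 →L[ℂ] lp (fun _ : X => ℂ) 2)
      (orbitMap G x b) = orbitMap G x (Finsupp.mapDomain (fun h => g * h) b) := by
    intro g
    rw [orbitMap, Finsupp.linearCombination_mapDomain, Finsupp.linearCombination_apply,
      Finsupp.linearCombination_apply, Finsupp.sum, Finsupp.sum, map_sum]
    refine Finset.sum_congr rfl fun h _ => ?_
    rw [map_smul, permRep_single, Function.comp_apply, mul_smul]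
  simp only [Finsupp.sum, sum_apply, smul_apply, key,
    map_sum, map_smul]

/-- The regular representation is weakly contained in `ℓ²(X)` if for every finite subset of `G`
some orbit map is injective on it. -/
theorem norm_sum_regularRep_le
    (hX : ∀ F : Finset G, ∃ x : X, Set.InjOn (fun g : G => g • x) F) (c : G →₀ ℂ) :
    ‖c.sum fun g a => a • (regularRep G g : lp (fun _ : G => ℂ) 2 →L[ℂ] lp (fun _ : G => ℂ) 2)‖ ≤
    ‖c.sum fun g a => a •
      (permRep G X g : lp (fun _ : X => ℂ) 2 →L[ℂ] lp (fun _ : X => ℂ) 2)‖ := by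
  classical
  set T := c.sum fun g a => a •
    (permRep G X g : lp (fun _ : X => ℂ) 2 →L[ℂ] lp (fun _ : X => ℂ) 2)
  set R := c.sum fun g a => a •
    (regularRep G g : lp (fun _ : G => ℂ) 2 →L[ℂ] lp (fun _ : G => ℂ) 2)
  have hfin : ∀ b : G →₀ ℂ, ‖R (orbitMap G (1 : G) b)‖ ≤ ‖T‖ * ‖orbitMap G (1 : G) b‖ := by
    intro b
    set b' := c.sum fun g a => a • Finsupp.mapDomain (fun h => g * h) b
    -- Injectivity on both supports makes the orbit map of `x` preserve the norms of the vector and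
    -- of its image.
    obtain ⟨x, hx⟩ := hX (b.support ∪ b'.support)
    have hnorm : ∀ d : G →₀ ℂ, d.support ⊆ b.support ∪ b'.support →
        ‖orbitMap G (1 : G) d‖ = ‖orbitMap G x d‖ := by
      intro d hd
      have h1 := norm_orbitMap (1 : G) d (fun g _ h _ hgh => by simpa using hgh)
      rw [← norm_orbitMap x d (hx.mono (by exact_mod_cast hd))] at h1
      exact (Real.rpow_left_inj (norm_nonneg _) (norm_nonneg _) (by norm_num)).1 h1
    have e1 : R (orbitMap G (1 : G) b) = orbitMap G (1 : G) b' := sum_permRep_orbitMap 1 c b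
    have e2 : T (orbitMap G x b) = orbitMap G x b' := sum_permRep_orbitMap x c b
    rw [e1, hnorm b' Finset.subset_union_right, hnorm b Finset.subset_union_left, ← e2]
    exact T.le_opNorm _
  refine R.opNorm_le_bound (norm_nonneg _) fun f => ?_
  -- Finitely supported vectors are dense, so the bound extends by continuity.
  have hf := lp.hasSum_single (p := 2) (by norm_num) f
  have hs : ∀ s : Finset G, ∑ g ∈ s, lp.single 2 g (f g) =
      orbitMap G (1 : G) (∑ g ∈ s, Finsupp.single g (f g)) := by
    intro s
    rw [map_sum]
    refine Finset.sum_congr rfl fun g _ => ?_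
    rw [orbitMap, Finsupp.linearCombination_single, ← lp.single_smul]
    simp
  refine le_of_tendsto_of_tendsto ((R.continuous.tendsto f).comp hf).norm
    (hf.norm.const_mul ‖T‖) (Filter.Eventually.of_forall fun s => ?_)
  simp only [Function.comp_apply, hs]
  exact hfin _

/-- A common fixed unit vector bounds the norms of sums of group elements from below. -/
theorem card_le_norm_sum_permRep (s : Finset G) (x : X) (hx : ∀ g ∈ s, g • x = x) :
    (s.card : ℝ) ≤
      ‖∑ g ∈ s, (permRep G X g : lp (fun _ : X => ℂ) 2 →L[ℂ] lp (fun _ : X => ℂ) 2)‖ := by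
  classical
  have h := (∑ g ∈ s, (permRep G X g : lp (fun _ : X => ℂ) 2 →L[ℂ] lp (fun _ : X => ℂ) 2)).le_opNorm
    (lp.single 2 x (1 : ℂ))
  rw [sum_apply, Finset.sum_congr rfl fun g hg => by
    rw [permRep_single, hx g hg], Finset.sum_const, ← Nat.cast_smul_eq_nsmul ℝ, norm_smul,
    lp.norm_single (by norm_num)] at h
  simpa using h

/-! ### Almost invariant vectors and invariant means -/

/-- This is uniform convexity: if unit vectors have a sum of nearly maximal norm, any two of them
nearly agree. Including 1 in the index set makes `ξ` itself a summand. -/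
theorem exists_almost_invariant_vector
    (h : ∀ s : Finset G, (s.card : ℝ) ≤
      ‖∑ g ∈ s, (permRep G X g : lp (fun _ : X => ℂ) 2 →L[ℂ] lp (fun _ : X => ℂ) 2)‖)
    (s : Finset G) {ε : ℝ} (hε : 0 < ε) :
    ∃ ξ : lp (fun _ : X => ℂ) 2, ‖ξ‖ = 1 ∧ ∀ g ∈ s,
      ‖(permRep G X g : lp (fun _ : X => ℂ) 2 →L[ℂ] lp (fun _ : X => ℂ) 2) ξ - ξ‖ ≤ ε := by
  classical
  let ρ : G → lp (fun _ : X => ℂ) 2 →L[ℂ] lp (fun _ : X => ℂ) 2 := fun g => permRep G X g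
  let t := insert 1 s
  let T := ∑ g ∈ t, ρ g
  -- The parallelogram law will bound the squared difference by 4 - (2 - δ)² ≤ 4δ; δ ≤ 1 keeps |t| -
  -- δ non-negative, so that `x` is non-zero.
  obtain ⟨δ, hδ, hδ1, hδε⟩ : ∃ δ : ℝ, 0 < δ ∧ δ ≤ 1 ∧ 4 * δ ≤ ε ^ 2 :=
    ⟨min 1 (ε ^ 2 / 4), by positivity, min_le_left _ _, by
      have := min_le_right 1 (ε ^ 2 / 4); linarith⟩
  have ht : 1 ≤ (t.card : ℝ) := by
    exact_mod_cast Finset.card_pos.2 ⟨1, Finset.mem_insert_self _ _⟩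
  obtain ⟨x, hx1, hx⟩ := T.exists_lt_apply_of_lt_opNorm (r := t.card - δ) (by
    have := h t
    change (t.card : ℝ) ≤ ‖T‖ at this
    linarith)
  have hx0 : 0 < ‖x‖ := by
    rw [norm_pos_iff]
    rintro rfl
    rw [map_zero, norm_zero] at hx
    linarith
  let ξ := ((‖x‖⁻¹ : ℝ) : ℂ) • x
  have hξ : ‖ξ‖ = 1 := by
    simp only [ξ, norm_smul, Complex.norm_real, norm_inv, norm_norm]
    exact inv_mul_cancel₀ hx0.ne'
  have hTξ : t.card - δ < ‖T ξ‖ := by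
    have : ‖T ξ‖ = ‖x‖⁻¹ * ‖T x‖ := by
      simp only [ξ, map_smul, norm_smul, Complex.norm_real, norm_inv, norm_norm]
    rw [this]
    exact hx.trans_le (le_mul_of_one_le_left (norm_nonneg _) ((one_le_inv₀ hx0).2 hx1.le))
  refine ⟨ξ, hξ, fun g hg => ?_⟩
  change ‖ρ g ξ - ξ‖ ≤ ε
  have hρ : ∀ g, ‖ρ g ξ‖ = 1 := fun g => (norm_permRep_apply g ξ).trans hξ
  have hρ1 : ρ 1 ξ = ξ := by simp [ρ]
  by_cases hg1 : g = 1
  · rw [hg1, hρ1, sub_self, norm_zero]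
    exact hε.le
  have hsum : T ξ = (ρ g ξ + ξ) + ∑ k ∈ (t.erase 1).erase g, ρ k ξ := by
    rw [sum_apply,
      ← Finset.add_sum_erase t (fun k => ρ k ξ) (Finset.mem_insert_self 1 s),
      ← Finset.add_sum_erase (t.erase 1) (fun k => ρ k ξ)
        (Finset.mem_erase.2 ⟨hg1, Finset.mem_insert_of_mem hg⟩), hρ1]
    abel
  have hcard : (((t.erase 1).erase g).card : ℝ) + 2 = t.card := by
    have h1 := Finset.card_erase_add_one (Finset.mem_erase.2 ⟨hg1, Finset.mem_insert_of_mem hg⟩ :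
      g ∈ t.erase 1)
    have h2 : (t.erase 1).card + 1 = t.card :=
      Finset.card_erase_add_one (Finset.mem_insert_self 1 s)
    exact_mod_cast (by omega : ((t.erase 1).erase g).card + 2 = t.card)
  have hrest : ‖∑ k ∈ (t.erase 1).erase g, ρ k ξ‖ ≤ ((t.erase 1).erase g).card := by
    refine (norm_sum_le _ _).trans ?_
    simp [hρ]
  have hadd : 2 - δ ≤ ‖ρ g ξ + ξ‖ := by
    have := norm_add_le (ρ g ξ + ξ) (∑ k ∈ (t.erase 1).erase g, ρ k ξ)
    rw [← hsum] at this
    linarith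
  have hpar := parallelogram_law_with_norm ℂ (ρ g ξ) ξ
  rw [hρ, hξ] at hpar
  refine le_of_sq_le_sq ?_ hε.le
  nlinarith

/-- The restriction of a vector of `ℓ²(X)` to a subset. -/
noncomputable def lpRestrict (A : Set X) (f : lp (fun _ : X => ℂ) 2) : lp (fun _ : X => ℂ) 2 :=
  ⟨A.indicator f, (lp.memℓp f).mono' fun _ => norm_indicator_le_norm_self _ _⟩

theorem norm_lpRestrict_sq (A : Set X) (f : lp (fun _ : X => ℂ) 2) :
    HasSum (A.indicator fun x => ‖f x‖ ^ 2) (‖lpRestrict A f‖ ^ 2) := by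
  have h := lp.hasSum_norm (p := 2) (by norm_num) (lpRestrict A f)
  simp only [ENNReal.toReal_ofNat, Real.rpow_ofNat] at h
  convert h using 2 with x
  by_cases hx : x ∈ A <;> simp [lpRestrict, hx]

theorem norm_lpRestrict_le (A : Set X) (f : lp (fun _ : X => ℂ) 2) : ‖lpRestrict A f‖ ≤ ‖f‖ :=
  lp.norm_mono (by norm_num) fun _ => norm_indicator_le_norm_self _ _

theorem lpRestrict_sub (A : Set X) (f g : lp (fun _ : X => ℂ) 2) :
    lpRestrict A (f - g) = lpRestrict A f - lpRestrict A g := by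
  ext x
  exact congrFun (Set.indicator_sub A f g) x

theorem lpRestrict_univ (f : lp (fun _ : X => ℂ) 2) : lpRestrict Set.univ f = f := by
  ext x
  simp [lpRestrict]

theorem norm_lpRestrict_union_sq {A B : Set X} (hAB : Disjoint A B)
    (f : lp (fun _ : X => ℂ) 2) :
    ‖lpRestrict (A ∪ B) f‖ ^ 2 = ‖lpRestrict A f‖ ^ 2 + ‖lpRestrict B f‖ ^ 2 := by
  have h := (norm_lpRestrict_sq A f).add (norm_lpRestrict_sq B f)
  have h' := norm_lpRestrict_sq (A ∪ B) f
  rw [Set.indicator_union_of_disjoint hAB] at h'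
  exact h'.unique h

theorem norm_lpRestrict_image (g : G) (A : Set X) (f : lp (fun _ : X => ℂ) 2) :
    ‖lpRestrict ((fun x => g • x) '' A) f‖ = ‖lpRestrict A
      ((permRep G X g⁻¹ : lp (fun _ : X => ℂ) 2 →L[ℂ] lp (fun _ : X => ℂ) 2) f)‖ := by
  rw [← norm_permRep_apply g⁻¹]
  congr 1
  ext x
  rw [permRep_apply, inv_inv]
  have hf : (permRep G X g⁻¹ : lp (fun _ : X => ℂ) 2 →L[ℂ] lp (fun _ : X => ℂ) 2) f x =
      f (g • x) := by rw [permRep_apply, inv_inv]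
  change Set.indicator _ _ _ = Set.indicator _ _ _
  by_cases hx : x ∈ A
  · rw [Set.indicator_of_mem hx, Set.indicator_of_mem (Set.mem_image_of_mem _ hx), hf]
  · rw [Set.indicator_of_notMem hx, Set.indicator_of_notMem]
    simpa using hx

theorem abs_norm_lpRestrict_sq_sub_le (A : Set X) {f g : lp (fun _ : X => ℂ) 2}
    (hf : ‖f‖ = 1) (hg : ‖g‖ = 1) :
    |‖lpRestrict A f‖ ^ 2 - ‖lpRestrict A g‖ ^ 2| ≤ 2 * ‖f - g‖ := by
  have h1 := norm_lpRestrict_le A f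
  have h2 := norm_lpRestrict_le A g
  have h3 : |‖lpRestrict A f‖ - ‖lpRestrict A g‖| ≤ ‖f - g‖ :=
    (abs_norm_sub_norm_le _ _).trans (lpRestrict_sub A f g ▸ norm_lpRestrict_le A (f - g))
  rw [sq_sub_sq, abs_mul, abs_of_nonneg (by positivity)]
  exact mul_le_mul (by linarith) h3 (abs_nonneg _) (by norm_num)

open Filter Topology in
/-- If the trivial representation is weakly contained in `ℓ²(X)`, then `X` carries an invariant
mean. -/
theorem hasInvariantMean_of_card_le_norm_sum
    (h : ∀ s : Finset G, (s.card : ℝ) ≤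
      ‖∑ g ∈ s, (permRep G X g : lp (fun _ : X => ℂ) 2 →L[ℂ] lp (fun _ : X => ℂ) 2)‖) :
    HasInvariantMean G X := by
  classical
  have hvec := fun i : Finset G × ℕ =>
    exists_almost_invariant_vector h i.1 (ε := 1 / ((i.2 : ℝ) + 1)) (by positivity)
  choose ξ hξ hinv using hvec
  let U : Ultrafilter (Finset G × ℕ) := Ultrafilter.of atTop
  -- These are the probability measures with densities |ξ i|². Their limit along `U` exists by
  -- compactness of [0, 1]; as `U` refines `atTop`, the error of invariance, at most 2/(n+1),
  -- vanishes in the limit.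
  let μ : Finset G × ℕ → Set X → ℝ := fun i A => ‖lpRestrict A (ξ i)‖ ^ 2
  have hμ : ∀ A, ∃ a, Tendsto (fun i => μ i A) U (𝓝 a) := by
    intro A
    obtain ⟨a, -, ha⟩ := (isCompact_Icc (a := (0 : ℝ)) (b := 1)).ultrafilter_le_nhds
      (U.map fun i => μ i A) (by
        rw [le_principal_iff, Ultrafilter.mem_coe, Ultrafilter.mem_map]
        refine Filter.mem_of_superset univ_mem fun i _ => ⟨sq_nonneg _, ?_⟩
        exact pow_le_one₀ (norm_nonneg _) ((norm_lpRestrict_le A _).trans (hξ i).le))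
    exact ⟨a, ha⟩
  choose m hm using hμ
  refine ⟨m, fun A => ge_of_tendsto' (hm A) fun i => by positivity, ?_, fun A B hAB => ?_,
    fun g A => ?_⟩
  · refine tendsto_nhds_unique (hm Set.univ) ?_
    simp only [μ, lpRestrict_univ, hξ, one_pow]
    exact tendsto_const_nhds
  · refine tendsto_nhds_unique (hm (A ∪ B)) ?_
    simp only [μ, norm_lpRestrict_union_sq hAB]
    exact (hm A).add (hm B)
  · have hlim : Tendsto (fun i => μ i ((fun x => g • x) '' A) - μ i A) U (𝓝 0) := by
      refine Tendsto.mono_left ?_ (Ultrafilter.of_le atTop)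
      have h0 : Tendsto (fun i : Finset G × ℕ => 2 * (1 / ((i.2 : ℝ) + 1))) atTop (𝓝 0) := by
        have := (tendsto_one_div_add_atTop_nhds_zero_nat (𝕜 := ℝ)).const_mul 2
        rw [mul_zero] at this
        exact this.comp (tendsto_snd.mono_left prod_atTop_atTop_eq.ge)
      refine squeeze_zero_norm' ?_ h0
      filter_upwards [eventually_ge_atTop (({g⁻¹}, 0) : Finset G × ℕ)] with i hi
      have hgi : g⁻¹ ∈ i.1 := hi.1 (Finset.mem_singleton_self _)
      rw [Real.norm_eq_abs]
      simp only [μ]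
      rw [norm_lpRestrict_image]
      refine (abs_norm_lpRestrict_sq_sub_le A
        ((norm_permRep_apply _ _).trans (hξ i)) (hξ i)).trans ?_
      have := hinv i g⁻¹ hgi
      linarith
    have := tendsto_nhds_unique hlim ((hm _).sub (hm A))
    linarith

end PermRep

/-! ### Exotic quasi-regular representations -/

section Exotic

universe u

variable {G : Type u} [Group G]

theorem sum_sum_single_smul {ι V : Type*} [AddCommMonoid V] [Module ℂ V] (s : Finset ι)
    (v : ι → V) : ((∑ i ∈ s, Finsupp.single i (1 : ℂ)).sum fun i a => a • v i) = ∑ i ∈ s, v i := by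
  rw [← Finsupp.linearCombination_apply, map_sum]
  simp

/-- Every unitary representation is weakly contained in the universal one. -/
theorem norm_sum_le_universalRep (π : UnitaryRep G) (c : G →₀ ℂ) :
    ‖c.sum fun g a => a • (π.hom g : π.space →L[ℂ] π.space)‖ ≤
    ‖c.sum fun g a => a • (universalRep G g : lp (fun π : UnitaryRep G => π.space) 2 →L[ℂ]
      lp (fun π : UnitaryRep G => π.space) 2)‖ := by
  classical
  refine ContinuousLinearMap.opNorm_le_bound _ (norm_nonneg _) fun v => ?_
  set T := c.sum fun g a => a • (universalRep G g : lp (fun π : UnitaryRep G => π.space) 2 →L[ℂ]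
      lp (fun π : UnitaryRep G => π.space) 2)
  have hcoord : ∀ f, (T f) π = (c.sum fun g a => a • (π.hom g : π.space →L[ℂ] π.space)) (f π) := by
    intro f
    have hg : ∀ g, ((universalRep G g : lp (fun π : UnitaryRep G => π.space) 2 →L[ℂ]
      lp (fun π : UnitaryRep G => π.space) 2) f) π = (π.hom g : π.space →L[ℂ] π.space) (f π) :=
      fun g => rfl
    simp only [T, Finsupp.sum, sum_apply, smul_apply,
      lp.coeFn_sum, Finset.sum_apply, lp.coeFn_smul, Pi.smul_apply, hg]
  have h1 := hcoord (lp.single 2 π v)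
  rw [lp.single_apply_self] at h1
  rw [← h1]
  refine (lp.norm_apply_le_norm (by norm_num) _ _).trans ((T.le_opNorm _).trans ?_)
  rw [lp.norm_single (by norm_num)]

/-- For an unconfined subgroup, orbit maps on the coset space are injective on given finite
sets. -/
theorem IsUnconfined.exists_injOn {H : Subgroup G} (hH : IsUnconfined H) (F : Finset G) :
    ∃ x : G ⧸ H, Set.InjOn (fun g : G => g • x) F := by
  classical
  -- The cosets aγH and bγH agree exactly when a⁻¹b lies in γHγ⁻¹, so γ is chosen to avoid the
  -- non-trivial quotients.
  obtain ⟨γ, hγ⟩ := hH (((F ×ˢ F).image fun p => p.1⁻¹ * p.2).erase 1) (by simp)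
  refine ⟨(γ : G ⧸ H), fun a ha b hb hab => ?_⟩
  have hmem : (a * γ)⁻¹ * (b * γ) ∈ H := QuotientGroup.eq.1 hab
  have h := hγ _ hmem
  have heq : γ * ((a * γ)⁻¹ * (b * γ)) * γ⁻¹ = a⁻¹ * b := by group
  rw [heq, Finset.mem_erase, not_and'] at h
  have := h (Finset.mem_image.2 ⟨(a, b), Finset.mem_product.2 ⟨ha, hb⟩, rfl⟩)
  exact inv_mul_eq_one.1 (not_not.1 this)

/-- The quasi-regular representation of an unconfined subgroup that is neither amenable nor
co-amenable generates an exotic C⋆-algebra. -/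
theorem IsUnconfined.isExotic {H : Subgroup G} (hH : IsUnconfined H)
    (hamen : ¬ IsAmenableGroup H) (hco : ¬ IsCoamenable H) : IsExotic (quasiRegularRep H) := by
  classical
  obtain ⟨p, hp, hpsurj⟩ := exists_canonical_epimorphism (universalRep G) (quasiRegularRep H)
    (norm_sum_le_universalRep ⟨lp (fun _ : G ⧸ H => ℂ) 2, quasiRegularRep H⟩)
  obtain ⟨q, hq, hqsurj⟩ := exists_canonical_epimorphism (quasiRegularRep H) (regularRep G)
    (norm_sum_regularRep_le hH.exists_injOn)
  refine ⟨p, q, hp, hq, hpsurj, hqsurj, fun hbij => hco ?_, fun hbij => hamen ?_⟩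
  -- The trivial representation, realised on ℓ² of a point, gives norm at least |s| in the universal
  -- representation; an isometric `p` carries this to G/H.
  · refine hasInvariantMean_of_card_le_norm_sum fun s => ?_
    have h1 := norm_sum_eq_of_canonical_injective p hp hbij.1 s
    have h2 := card_le_norm_sum_permRep s PUnit.unit.{u + 1} fun _ _ => rfl
    have h3 := norm_sum_le_universalRep
      ⟨lp (fun _ : PUnit.{u + 1} => ℂ) 2, permRep G PUnit.{u + 1}⟩
      (∑ g ∈ s, Finsupp.single g 1)
    rw [sum_sum_single_smul, sum_sum_single_smul] at h3
    exact h2.trans (h3.trans h1.ge)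
  -- The point mass at the base coset is fixed by H; an isometric `q` carries the resulting norm
  -- bound to ℓ²(G), viewed as a representation of H.
  · refine isAmenableGroup_of_hasInvariantMean_subgroup H
      (hasInvariantMean_of_card_le_norm_sum fun s => ?_)
    have h1 := norm_sum_eq_of_canonical_injective q hq hbij.1 (s.map ⟨_, H.subtype_injective⟩)
    have h2 := card_le_norm_sum_permRep (s.map ⟨_, H.subtype_injective⟩) ((1 : G) : G ⧸ H)
      (fun g hg => by
        obtain ⟨h, -, rfl⟩ := Finset.mem_map.1 hg
        rw [MulAction.Quotient.smul_coe, QuotientGroup.eq]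
        simp)
    rw [Finset.card_map] at h2
    refine h2.trans (h1.ge.trans (le_of_eq ?_))
    rw [Finset.sum_map]
    rfl

end Exotic

theorem mainTheorem2 {L Z : Type*} [Group L] [Group Z]
    (hL : ¬ IsAmenableGroup L) (hLfree : HasNoNonabelianFreeSubgroup L) [Nontrivial Z] :
    ¬ IsAmenableGroup (lampSubgroup L Z) ∧
    ¬ IsCoamenable (lampSubgroup L Z) ∧
    (Infinite Z →
      IsUnconfined (lampSubgroup L Z) ∧ IsExotic (quasiRegularRep (lampSubgroup L Z))) ∧
    (HasNoNonabelianFreeSubgroup Z → HasNoNonabelianFreeSubgroup (restrictedWreath L Z)) :=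
  ⟨not_isAmenableGroup_lampSubgroup hL, not_isCoamenable_lampSubgroup hL,
    fun _ => ⟨isUnconfined_lampSubgroup, isUnconfined_lampSubgroup.isExotic
      (not_isAmenableGroup_lampSubgroup hL) (not_isCoamenable_lampSubgroup hL)⟩,
    hasNoNonabelianFreeSubgroup_restrictedWreath hLfree⟩
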